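/- Setting. There are $K\ge 2$ actions; action $i$ has a reward distribution $\nu_i$ on $[0,1]$ with mean $\mu_i$. In each round $t$ the learner plays an action $i_t$ and decides whether to verify the round; the true reward $r_t(i_t)$ is drawn from $\nu_{i_t}$ independently of the past. The learner observes $r^o_t(i_t)=r_t(i_t)$ if the round is verified; otherwise the attacker chooses $r^o_t(i_t)\in[0,1]$ as a function of the actions and true rewards up to round $t$. An algorithm chooses its next action and whether to verify (possibly at random) on the basis of its past actions, verification decisions and observed rewards only. $N^s_T$ is the number of verified rounds among the first $T$, and the regret of $\mathcal A$ is $R^{\mathcal A}(T)=T\max_i\mu_i-\mathbb E\big[\sum_{t=1}^T r_t(i_t)\big]$. The zero attack sets the observed reward to $0$ in every round that is not verified. For a class $\mathcal D$ of distributions on $[0,1]$, an algorithm is consistent (under the zero attack) if, for every choice of $K$ reward distributions in $\mathcal D$ with a unique optimal action $b$, $\mathbb P(i_t\ne b)\to0$ as $t\to\infty$ when the zero attack is used. Theorem. Let $\nu_1,\dots,\nu_K\in\mathcal D$ have a unique optimal action $i^*$, and suppose that $KL(\nu_i,\nu_j)<\infty$ for all $i,j$. (1) Suppose that $\nu_1,\dots,\nu_K$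 are pairwise distinct. There is a constant $c>0$, depending only on $(\nu_i)_i$, such that for all $0<\alpha<1$, all $\beta>1$ and every consistent algorithm $\mathcal A$ there is a time $t^*$ with the following property. For every $T\ge 2t^*$ with $(\log T)^{1-\alpha}+\beta\log(4\log T)\le\log T$, if under the zero attack $$N^s_T<\frac{(\log T)^{1-\alpha}}{\min_{i_1\ne i_2}KL(\nu_{i_1},\nu_{i_2})}\quad\text{almost surely},$$ then under the zero attack $R^{\mathcal A}(T)\ge c\,(\log T)^\beta$. (2) Hence $\Omega(\log T)$ verifications are needed for $O(\log T)$ regret: there is a constant $c>0$, depending only on $(\nu_i)_i$, such that for every consistent algorithm $\mathcal A$ with $R^{\mathcal A}(T)=O(\log T)$ under the zero attack, and for all sufficiently large $T$, it is not the case that $N^s_T<c\log T$ almost surely under the zero attack. -/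

import Mathlib

open MeasureTheory ProbabilityTheory Filter

open scoped Topology

noncomputable section

namespace VerifiedBandit

/-- What the learner decides in a round: which of the `K` actions to play, and whether to verify. -/
abbrev Decision (K : ℕ) := Fin K × Bool

/-- What the learner sees of a round: its own decision and the observed reward. -/
abbrev Observation (K : ℕ) := Decision K × unitInterval

/-- Everything that happens in a round: the decision, the true reward of the action played, and
the observed reward. All rewards lie in `[0,1]`. -/
abbrev Round (K : ℕ) := Decision K × unitInterval × unitInterval

variable {K : ℕ}

/-- The action played in a round. -/
def Round.arm (x : Round K) : Fin K := x.1.1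

/-- Whether the round is verified. -/
def Round.verified (x : Round K) : Bool := x.1.2

/-- The true reward of the action played. -/
def Round.trueReward (x : Round K) : unitInterval := x.2.1

/-- The part of a round that the learner sees. -/
def Round.obs (x : Round K) : Observation K := (x.1, x.2.2)

/-- A stochastic bandit with `K` actions: the reward distributions on `[0,1]`. -/
abbrev Bandit (K : ℕ) := Fin K → ProbabilityMeasure unitInterval

/-- The expected reward of an action. -/
def Bandit.mean (p : Bandit K) (i : Fin K) : ℝ := ∫ x, (x : ℝ) ∂(p i : Measure unitInterval)

/-- `b` is the unique optimal action. -/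
def Bandit.IsBest (p : Bandit K) (b : Fin K) : Prop := ∀ i, i ≠ b → p.mean i < p.mean b

/-- `KL(i, j)`, the Kullback-Leibler divergence between the reward distributions of two actions. -/
def Bandit.kl (p : Bandit K) (i j : Fin K) : ENNReal :=
  InformationTheory.klDiv (p i : Measure unitInterval) (p j : Measure unitInterval)

/-- The smallest Kullback-Leibler divergence between two different actions. -/
def Bandit.minKL (p : Bandit K) : ENNReal := ⨅ (i : Fin K) (j : Fin K) (_ : i ≠ j), p.kl i j

/-- A (possibly randomized) learning algorithm with verification: the decision of the next round
is drawn from a distribution that is a measurable function of the observed history. Deterministic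
algorithms are the case of deterministic kernels. -/
structure Algorithm (K : ℕ) where
  policy : (n : ℕ) → Kernel (Fin n → Observation K) (Decision K)
  markov : ∀ n, IsMarkovKernel (policy n)

/-- An attack: the corrupted reward of a round, as a function of the actions played and the true
rewards they gave, up to and including that round. -/
structure Attack (K : ℕ) where
  corrupt : (n : ℕ) → (Fin (n + 1) → Fin K × unitInterval) → unitInterval
  measurable : ∀ n, Measurable (corrupt n)

/-- The attack that sets every observed reward to `0`. -/
def zeroAttack (K : ℕ) : Attack K where
  corrupt _ _ := 0
  measurable _ := measurable_const

theorem measurable_obsHistory (n : ℕ) :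
    Measurable (fun (h : Fin n → Round K) (k : Fin n) => (h k).obs) := by
  unfold Round.obs
  fun_prop

/-- The distribution of the next decision, given the past rounds. -/
def decisionKernel (A : Algorithm K) (n : ℕ) : Kernel (Fin n → Round K) (Decision K) :=
  (A.policy n).comap (fun h k => (h k).obs) (measurable_obsHistory n)

/-- The distribution of the true reward, given the past rounds and the current decision: it depends
only on the action played. -/
def rewardKernel (p : Bandit K) (n : ℕ) :
    Kernel ((Fin n → Round K) × Decision K) unitInterval :=
  Kernel.prodMkLeft (Fin n → Round K)
    (Kernel.ofFunOfCountable fun d : Decision K => (p d.1 : Measure unitInterval))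

/-- The observed reward, given the past rounds `h`, the decision `d` and the true reward `r`:
the true reward if the round is verified, and what the attacker makes of it otherwise. -/
def observed (att : Attack K) {n : ℕ} (h : Fin n → Round K) (d : Decision K) (r : unitInterval) :
    unitInterval :=
  if d.2 = true then r
  else att.corrupt n (Fin.snoc (α := fun _ => Fin K × unitInterval)
    (fun k => ((h k).arm, (h k).trueReward)) (d.1, r))

/-- The law of the first `T` rounds when `A` plays against the bandit `p` under the attack `att`. -/
def law (p : Bandit K) (A : Algorithm K) (att : Attack K) :
    (T : ℕ) → Measure (Fin T → Round K)
  | 0 => Measure.dirac Fin.elim0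
  | n + 1 =>
    ((law p A att n ⊗ₘ decisionKernel A n) ⊗ₘ rewardKernel p n).map fun x =>
      Fin.snoc (α := fun _ => Round K) x.1.1 (x.1.2, x.2, observed att x.1.1 x.1.2 x.2)

/-- The number of verified rounds. -/
def numVerified {T : ℕ} (h : Fin T → Round K) : ℕ :=
  (Finset.univ.filter fun t => (h t).verified = true).card

/-- The expected regret over `T` rounds, measured in true rewards, where `b` is the optimal
action. -/
def regret (p : Bandit K) (b : Fin K) (A : Algorithm K) (att : Attack K) (T : ℕ) : ℝ :=
  T * p.mean b - ∫ h, ∑ t, ((h t).trueReward : ℝ) ∂(law p A att T)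

/-- `A` is consistent under the attack `att`, for bandits with reward distributions in `D`: whatever
the bandit with reward distributions in `D` and a unique optimal action, the probability that `A`
plays a suboptimal action in round `t` tends to `0` as `t` tends to infinity. -/
def IsConsistent (D : Set (ProbabilityMeasure unitInterval)) (A : Algorithm K) (att : Attack K) :
    Prop :=
  ∀ (q : Bandit K) (b : Fin K), (∀ i, q i ∈ D) → q.IsBest b →
    Tendsto (fun t : ℕ => (law q A att (t + 1)).real {h | (h (Fin.last t)).arm ≠ b}) atTop (𝓝 0)

end VerifiedBandit

end

/-! Change of measure against a permuted bandit. Pick a suboptimal arm `j` and let `q` be `p` with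
the distributions of `j` and the best arm exchanged. Then `j` is optimal for `q`, whose
distributions still lie in `D`, so by consistency `j` is eventually played against `q` with
probability at least 1/2.

Under the zero attack an unverified round reveals nothing about the rewards. By the chain rule, the
divergence between the observation laws under `q` and `p` is at most `C` times the expected number
of verifications (`klDiv_obsLaw_le`), hence at most `C * M` when fewer than `M` rounds are verified.
An event likely under `q` keeps probability of order `exp (-2 * C * M)` under `p`
(`half_exp_neg_le_measureReal`). Summing over the last half of the rounds gives regret at least of
order `T * exp (-2 * C * M)` (`exists_mul_exp_le_regret`). Both claims follow by choosing `M` so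
that the exponent is at most `log T / 2`: the regret is then at least of order `√T`. -/

/-! ### Divergence of kernels and of restricted measures -/

section KullbackLeibler

open InformationTheory
open scoped ENNReal

variable {X Y : Type*} {mX : MeasurableSpace X} {mY : MeasurableSpace Y}

theorem compProd_eq_withDensity_rnDeriv [MeasurableSpace.CountableOrCountablyGenerated X Y]
    (μ : Measure X) [IsFiniteMeasure μ] (κ η : Kernel X Y) [IsFiniteKernel κ] [IsFiniteKernel η]
    (hac : ∀ x, κ x ≪ η x) :
    μ ⊗ₘ κ = (μ ⊗ₘ η).withDensity (fun z => Kernel.rnDeriv κ η z.1 z.2) := by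
  have hm : Measurable (fun z : X × Y => Kernel.rnDeriv κ η z.1 z.2) :=
    Kernel.measurable_rnDeriv κ η
  ext s hs
  rw [Measure.compProd_apply hs, withDensity_apply _ hs, ← lintegral_indicator hs,
    Measure.lintegral_compProd (hm.indicator hs)]
  refine lintegral_congr fun x => ?_
  have hs' : MeasurableSet (Prod.mk x ⁻¹' s) := measurable_prodMk_left hs
  rw [← Kernel.setLIntegral_rnDeriv (hac x) hs', ← lintegral_indicator hs']
  rfl

/-- With a common first marginal, the joint density is the fibrewise density, so the `klFun`
integral disintegrates. -/
theorem klDiv_compProd_right [MeasurableSpace.CountableOrCountablyGenerated X Y]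
    (μ : Measure X) [IsFiniteMeasure μ] (κ η : Kernel X Y) [IsFiniteKernel κ] [IsFiniteKernel η]
    (hac : ∀ x, κ x ≪ η x) :
    klDiv (μ ⊗ₘ κ) (μ ⊗ₘ η) = ∫⁻ x, klDiv (κ x) (η x) ∂μ := by
  have hm : Measurable (fun z : X × Y => Kernel.rnDeriv κ η z.1 z.2) :=
    Kernel.measurable_rnDeriv κ η
  have hd : (μ ⊗ₘ κ).rnDeriv (μ ⊗ₘ η) =ᵐ[μ ⊗ₘ η] fun z => Kernel.rnDeriv κ η z.1 z.2 := by
    rw [compProd_eq_withDensity_rnDeriv μ κ η hac]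
    exact Measure.rnDeriv_withDensity _ hm
  rw [klDiv_eq_lintegral_klFun_of_ac
    (Measure.AbsolutelyContinuous.compProd_right (ae_of_all _ hac)),
    lintegral_congr_ae (hd.mono fun z hz => by rw [hz]), Measure.lintegral_compProd (by fun_prop)]
  refine lintegral_congr fun x => ?_
  rw [klDiv_eq_lintegral_klFun_of_ac (hac x)]
  refine lintegral_congr_ae ?_
  filter_upwards [Kernel.rnDeriv_eq_rnDeriv_measure (κ := κ) (η := η) (a := x)] with y hy
  rw [hy]

/-- The density is unchanged on `s` and `klFun` is nonnegative, so restriction only discards part of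
the integral. -/
theorem klDiv_restrict_le (μ ν : Measure X) [IsFiniteMeasure μ] [IsFiniteMeasure ν]
    {s : Set X} (hs : MeasurableSet s) :
    klDiv (μ.restrict s) (ν.restrict s) ≤ klDiv μ ν := by
  by_cases hac : μ ≪ ν
  swap; · simp [klDiv_of_not_ac hac]
  have hd : (μ.restrict s).rnDeriv (ν.restrict s) =ᵐ[ν.restrict s] μ.rnDeriv ν := by
    have : μ.restrict s = (ν.restrict s).withDensity (μ.rnDeriv ν) := by
      conv_lhs => rw [← Measure.withDensity_rnDeriv_eq μ ν hac]
      rw [restrict_withDensity hs]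
    conv_lhs => rw [this]
    exact Measure.rnDeriv_withDensity _ (Measure.measurable_rnDeriv μ ν)
  rw [klDiv_eq_lintegral_klFun_of_ac hac, klDiv_eq_lintegral_klFun_of_ac (hac.restrict s)]
  calc _ = ∫⁻ x in s, ENNReal.ofReal (klFun (μ.rnDeriv ν x).toReal) ∂ν :=
        lintegral_congr_ae (hd.mono fun x hx => by
          change _ = ENNReal.ofReal (klFun (μ.rnDeriv ν x).toReal)
          rw [hx])
    _ ≤ _ := setLIntegral_le_lintegral _ _

/-- An event that is likely under `μ` is not too unlikely under `ν`. -/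
theorem half_exp_neg_le_measureReal (μ ν : Measure X) [IsProbabilityMeasure μ]
    [IsProbabilityMeasure ν] {s : Set X} (hs : MeasurableSet s) (hμ : 1 / 2 ≤ μ.real s)
    {B : ℝ} (hB : klDiv μ ν ≤ ENNReal.ofReal B) (hB0 : 0 ≤ B) :
    1 / 2 * Real.exp (-(2 * (B + 1))) ≤ ν.real s := by
  have hfin : klDiv μ ν ≠ ⊤ := ne_top_of_le_ne_top ENNReal.ofReal_ne_top hB
  have hac : μ ≪ ν := (klDiv_ne_top_iff.1 hfin).1
  have hpos : 0 < ν.real s := by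
    refine lt_of_le_of_ne measureReal_nonneg fun h => ?_
    have h0 : ν s = 0 := (measureReal_eq_zero_iff).1 h.symm
    have : μ.real s = 0 := (measureReal_eq_zero_iff).2 (hac h0)
    linarith
  -- The bound by total masses, applied on `s` alone: `x log (x / y) + y - x ≤ B` with `x = μ s`, `y
  -- = ν s`.
  have h := (mul_log_le_klDiv (μ.restrict s) (ν.restrict s)).trans
    ((klDiv_restrict_le μ ν hs).trans hB)
  rw [ENNReal.ofReal_le_ofReal_iff hB0] at h
  simp only [measureReal_restrict_apply_univ] at h
  have hμ1 : μ.real s ≤ 1 := measureReal_le_one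
  set x := μ.real s
  set y := ν.real s
  rw [Real.log_div (by linarith) hpos.ne'] at h
  have hlx : Real.log (1 / 2) ≤ Real.log x := Real.log_le_log (by norm_num) hμ
  -- `x ≤ 1` turns the bound into `x (log x - log y) ≤ B + 1`, and `1 / 2 ≤ x` costs the factor 2.
  have key : Real.log (1 / 2) - Real.log y ≤ 2 * (B + 1) := by
    by_contra! hc
    have h1 : 2 * (B + 1) < Real.log x - Real.log y := by linarith
    nlinarith
  rw [← Real.log_le_log_iff (by positivity) hpos, Real.log_mul (by norm_num) (Real.exp_pos _).ne',
    Real.log_exp]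
  linarith

end KullbackLeibler

/-! ### The law of the full history -/

namespace VerifiedBandit

open InformationTheory
open scoped ENNReal

variable {K : ℕ}

theorem measurable_snoc {α β : Type*} [MeasurableSpace α] [MeasurableSpace β] {n : ℕ}
    {f : β → Fin n → α} {g : β → α} (hf : Measurable f) (hg : Measurable g) :
    Measurable fun b => (Fin.snoc (α := fun _ => α) (f b) (g b) : Fin (n + 1) → α) := by
  refine measurable_pi_lambda _ fun i => ?_
  induction i using Fin.lastCases with
  | last => simpa using hg
  | cast i => simpa using measurable_pi_iff.1 hf i

instance (A : Algorithm K) (n : ℕ) : IsMarkovKernel (A.policy n) := A.markov n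

instance (A : Algorithm K) (n : ℕ) : IsMarkovKernel (decisionKernel A n) := by
  unfold decisionKernel; infer_instance

instance (p : Bandit K) : IsMarkovKernel
    (Kernel.ofFunOfCountable fun d : Decision K => (p d.1 : Measure unitInterval)) :=
  ⟨fun d => inferInstanceAs (IsProbabilityMeasure (p d.1 : Measure unitInterval))⟩

instance (p : Bandit K) (n : ℕ) : IsMarkovKernel (rewardKernel p n) := by
  unfold rewardKernel; infer_instance

theorem rewardKernel_apply (p : Bandit K) (n : ℕ) (z : (Fin n → Round K) × Decision K) :
    rewardKernel p n z = (p z.2.1 : Measure unitInterval) := rfl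

/-- The map that appends a round to the history, given the decision and the true reward. -/
def appendRound (att : Attack K) (n : ℕ) (x : ((Fin n → Round K) × Decision K) × unitInterval) :
    Fin (n + 1) → Round K :=
  Fin.snoc (α := fun _ => Round K) x.1.1 (x.1.2, x.2, observed att x.1.1 x.1.2 x.2)

theorem measurable_appendRound (att : Attack K) (n : ℕ) : Measurable (appendRound att n) := by
  have hobs : Measurable fun x : ((Fin n → Round K) × Decision K) × unitInterval =>
      observed att x.1.1 x.1.2 x.2 := by
    unfold observed
    refine Measurable.ite ?_ measurable_snd ((att.measurable n).comp
      (measurable_snoc ?_ ?_))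
    · exact (measurableSet_singleton true).preimage (by fun_prop)
    · unfold Round.arm Round.trueReward
      fun_prop
    · fun_prop
  exact measurable_snoc (by fun_prop) (by fun_prop)

theorem law_succ (p : Bandit K) (A : Algorithm K) (att : Attack K) (n : ℕ) :
    law p A att (n + 1) =
      ((law p A att n ⊗ₘ decisionKernel A n) ⊗ₘ rewardKernel p n).map (appendRound att n) := rfl

instance isProbabilityMeasure_law (p : Bandit K) (A : Algorithm K) (att : Attack K) (n : ℕ) :
    IsProbabilityMeasure (law p A att n) := by
  induction n with
  | zero => unfold law; infer_instance
  | succ n ih =>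
    rw [law_succ]
    exact Measure.isProbabilityMeasure_map (measurable_appendRound att n).aemeasurable

/-- The two laws share decisions and attack and differ only in the reward kernels. This carries
almost sure statements from `p` to `q`. -/
theorem law_absolutelyContinuous {p q : Bandit K}
    (hac : ∀ i, (q i : Measure unitInterval) ≪ (p i : Measure unitInterval))
    (A : Algorithm K) (att : Attack K) (n : ℕ) : law q A att n ≪ law p A att n := by
  induction n with
  | zero => exact Measure.AbsolutelyContinuous.rfl
  | succ n ih =>
    rw [law_succ, law_succ]
    exact ((ih.compProd_left _).compProd (ae_of_all _ fun z => hac z.2.1)).map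
      (measurable_appendRound att n)

theorem law_map_init (p : Bandit K) (A : Algorithm K) (att : Attack K) (n : ℕ) :
    (law p A att (n + 1)).map (fun h (k : Fin n) => h k.castSucc) = law p A att n := by
  rw [law_succ, Measure.map_map (by fun_prop) (measurable_appendRound att n)]
  have : (fun (h : Fin (n + 1) → Round K) (k : Fin n) => h k.castSucc) ∘ appendRound att n
      = Prod.fst ∘ Prod.fst := by
    ext x k : 2
    simp [appendRound]
  rw [this, ← Measure.map_map measurable_fst measurable_fst, ← Measure.fst, ← Measure.fst,
    Measure.fst_compProd, Measure.fst_compProd]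

theorem law_map_last_decision (p : Bandit K) (A : Algorithm K) (att : Attack K) (n : ℕ) :
    (law p A att (n + 1)).map (fun h => (h (Fin.last n)).1) =
      (law p A att n ⊗ₘ decisionKernel A n).snd := by
  rw [law_succ, Measure.map_map (by fun_prop) (measurable_appendRound att n)]
  have : (fun h : Fin (n + 1) → Round K => (h (Fin.last n)).1) ∘ appendRound att n
      = Prod.snd ∘ Prod.fst := by
    ext x : 1
    simp [appendRound]
  rw [this, ← Measure.map_map measurable_snd measurable_fst, ← Measure.fst, Measure.fst_compProd,
    ← Measure.snd]

/-! ### Information carried by the observations under the zero attack -/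

section Observations

/-- The distribution of the observed reward under the zero attack, given the decision. -/
noncomputable def obsRewardKernel (p : Bandit K) : Kernel (Decision K) unitInterval :=
  Kernel.ofFunOfCountable fun d => if d.2 = true then (p d.1 : Measure unitInterval) else
    Measure.dirac 0

theorem obsRewardKernel_apply (p : Bandit K) (d : Decision K) :
    obsRewardKernel p d = if d.2 = true then (p d.1 : Measure unitInterval) else
      Measure.dirac 0 := rfl

instance (p : Bandit K) : IsMarkovKernel (obsRewardKernel p) := by
  refine ⟨fun d => ?_⟩
  rw [obsRewardKernel_apply]
  split_ifs <;> infer_instance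

/-- The observation history of a history. -/
def obsHistory {n : ℕ} (h : Fin n → Round K) (k : Fin n) : Observation K := (h k).obs

theorem measurable_obsHistory_fun (n : ℕ) :
    Measurable (obsHistory : (Fin n → Round K) → Fin n → Observation K) :=
  measurable_obsHistory n

/-- The law of the observation history under the zero attack. -/
noncomputable def obsLaw (p : Bandit K) (A : Algorithm K) (n : ℕ) : Measure (Fin n → Observation K) :=
  (law p A (zeroAttack K) n).map obsHistory

instance (p : Bandit K) (A : Algorithm K) (n : ℕ) : IsProbabilityMeasure (obsLaw p A n) :=
  Measure.isProbabilityMeasure_map (measurable_obsHistory_fun n).aemeasurable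

/-- The map that appends an observation to the observation history. -/
def appendObs (n : ℕ) (x : ((Fin n → Observation K) × Decision K) × unitInterval) :
    Fin (n + 1) → Observation K :=
  Fin.snoc (α := fun _ => Observation K) x.1.1 (x.1.2, x.2)

theorem measurable_appendObs (n : ℕ) : Measurable (appendObs (K := K) n) :=
  measurable_snoc (by fun_prop) (by fun_prop)

theorem obsHistory_appendRound (n : ℕ)
    (x : ((Fin n → Round K) × Decision K) × unitInterval) :
    obsHistory (appendRound (zeroAttack K) n x) =
      appendObs n ((obsHistory x.1.1, x.1.2), if x.1.2.2 = true then x.2 else 0) := by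
  ext k : 1
  induction k using Fin.lastCases with
  | last => simp [obsHistory, appendRound, appendObs, Round.obs, observed, zeroAttack]
  | cast k => simp [obsHistory, appendRound, appendObs]

/-- The policy reads observations only, and under the zero attack the observed reward depends on the
past only through the decision, so true rewards of unverified rounds integrate out. On full
histories every round, verified or not, could add to the divergence. -/
theorem obsLaw_succ (p : Bandit K) (A : Algorithm K) (n : ℕ) :
    obsLaw p A (n + 1) =
      ((obsLaw p A n ⊗ₘ A.policy n) ⊗ₘ Kernel.prodMkLeft _ (obsRewardKernel p)).map
        (appendObs n) := by
  refine Measure.ext_of_lintegral _ fun f hf => ?_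
  have hf1 : Measurable fun x => f (appendObs n x) := hf.comp (measurable_appendObs n)
  have hm1 : Measurable fun x => f (obsHistory (appendRound (zeroAttack K) n x)) :=
    (hf.comp (measurable_obsHistory_fun (n + 1))).comp (measurable_appendRound (zeroAttack K) n)
  rw [lintegral_map hf (measurable_appendObs n), obsLaw, lintegral_map hf (measurable_obsHistory_fun _),
    law_succ, lintegral_map (f := fun h => f (obsHistory h)) (hf.comp (measurable_obsHistory_fun _))
      (measurable_appendRound _ _),
    Measure.lintegral_compProd hm1, Measure.lintegral_compProd hm1.lintegral_kernel_prod_right',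
    Measure.lintegral_compProd hf1, Measure.lintegral_compProd hf1.lintegral_kernel_prod_right',
    obsLaw, lintegral_map _ (measurable_obsHistory_fun n)]
  · refine lintegral_congr fun h => ?_
    refine lintegral_congr fun d => ?_
    simp only [obsHistory_appendRound, rewardKernel_apply,
      Kernel.prodMkLeft_apply, obsRewardKernel_apply]
    split_ifs with hd
    · rfl
    · simp [lintegral_dirac]
  · exact (hf1.lintegral_kernel_prod_right' 
      (κ := Kernel.prodMkLeft _ (obsRewardKernel p))).lintegral_kernel_prod_right' (κ := A.policy n)

theorem klDiv_obsRewardKernel_le {p q : Bandit K} {C : ℝ≥0∞}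
    (hC : ∀ i, klDiv (q i : Measure unitInterval) (p i : Measure unitInterval) ≤ C)
    (d : Decision K) :
    klDiv (obsRewardKernel q d) (obsRewardKernel p d) ≤ if d.2 = true then C else 0 := by
  simp only [obsRewardKernel_apply]
  split_ifs
  · exact hC _
  · simp

/-- The expected number of verified rounds. -/
noncomputable def expVerified (p : Bandit K) (A : Algorithm K) (att : Attack K) (n : ℕ) : ℝ≥0∞ :=
  ∫⁻ h, (numVerified h : ℝ≥0∞) ∂(law p A att n)

theorem numVerified_eq_sum {n : ℕ} (h : Fin n → Round K) :
    (numVerified h : ℝ≥0∞) = ∑ t, if (h t).1.2 = true then 1 else 0 := by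
  simp [numVerified, Round.verified]
  rfl

theorem measurable_numVerified (n : ℕ) :
    Measurable fun h : Fin n → Round K => (numVerified h : ℝ≥0∞) := by
  simp only [numVerified_eq_sum]
  refine Finset.measurable_sum _ fun t _ => ?_
  exact (Measurable.of_discrete (f := fun d : Decision K => if d.2 = true then (1 : ℝ≥0∞) else 0)).comp
    (by fun_prop : Measurable fun h : Fin n → Round K => (h t).1)

theorem expVerified_succ (p : Bandit K) (A : Algorithm K) (att : Attack K) (n : ℕ) :
    expVerified p A att (n + 1) = expVerified p A att n +
      ∫⁻ d, (if d.2 = true then 1 else 0) ∂(law p A att n ⊗ₘ decisionKernel A n).snd := by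
  unfold expVerified
  rw [← law_map_last_decision, lintegral_map Measurable.of_discrete (by fun_prop)]
  conv_rhs => rw [← law_map_init, lintegral_map (measurable_numVerified n) (by fun_prop)]
  rw [← lintegral_add_left (f := fun h : Fin (n + 1) → Round K =>
    (numVerified fun k : Fin n => h k.castSucc : ℝ≥0∞))
    ((measurable_numVerified n).comp (by fun_prop))]
  refine lintegral_congr fun h => ?_
  simp only [numVerified_eq_sum, Fin.sum_univ_castSucc]

theorem expVerified_mono (p : Bandit K) (A : Algorithm K) (att : Attack K) :
    Monotone (expVerified p A att) :=
  monotone_nat_of_le_succ fun n => by rw [expVerified_succ]; exact le_self_add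

theorem snd_obsLaw_compProd_policy (p : Bandit K) (A : Algorithm K) (n : ℕ) :
    (obsLaw p A n ⊗ₘ A.policy n).snd =
      (law p A (zeroAttack K) n ⊗ₘ decisionKernel A n).snd := by
  ext s hs
  rw [Measure.snd_apply hs, Measure.snd_apply hs, Measure.compProd_apply (measurable_snd hs),
    Measure.compProd_apply (measurable_snd hs), obsLaw,
    lintegral_map (Kernel.measurable_kernel_prodMk_left (measurable_snd hs))
      (measurable_obsHistory_fun n)]
  rfl

/-- Chain rule, round by round: the policy is common to both laws and contributes nothing, and a
reward contributes at most `C` if verified and zero otherwise. The expectation is under `q`, the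
first argument of the divergence. -/
theorem klDiv_obsLaw_le {p q : Bandit K} {C : ℝ≥0∞} (hCtop : C ≠ ⊤)
    (hC : ∀ i, klDiv (q i : Measure unitInterval) (p i : Measure unitInterval) ≤ C)
    (A : Algorithm K) (n : ℕ) :
    klDiv (obsLaw q A n) (obsLaw p A n) ≤ C * expVerified q A (zeroAttack K) n := by
  have hfin : ∀ i, klDiv (q i : Measure unitInterval) (p i : Measure unitInterval) ≠ ⊤ :=
    fun i => ne_top_of_le_ne_top hCtop (hC i)
  induction n with
  | zero =>
    have : obsLaw q A 0 = obsLaw p A 0 := rfl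
    rw [this, klDiv_self]
    exact zero_le
  | succ n ih =>
    rw [obsLaw_succ, obsLaw_succ, expVerified_succ, mul_add]
    refine (klDiv_map_le _ _ (measurable_appendObs n)).trans ?_
    rw [klDiv_compProd_eq_add, klDiv_compProd_left]
    refine add_le_add ih ?_
    rw [klDiv_compProd_right]
    · simp only [Kernel.prodMkLeft_apply]
      rw [← snd_obsLaw_compProd_policy, Measure.snd,
        lintegral_map Measurable.of_discrete measurable_snd, ← lintegral_const_mul' _ _ hCtop]
      refine lintegral_mono fun z => (klDiv_obsRewardKernel_le hC z.2).trans ?_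
      split_ifs <;> simp
    · intro z
      refine (klDiv_ne_top_iff.1 (ne_top_of_le_ne_top ?_
        (klDiv_obsRewardKernel_le hC z.2))).1
      split_ifs
      · exact hCtop
      · simp

end Observations

/-! ### Regret decomposition -/

section Regret

theorem integrable_trueReward (p : Bandit K) (A : Algorithm K) (att : Attack K) {n : ℕ}
    (t : Fin n) : Integrable (fun h => ((h t).trueReward : ℝ)) (law p A att n) := by
  refine Integrable.of_bound (C := 1) (Measurable.aestronglyMeasurable ?_) (ae_of_all _ fun h => ?_)
  · unfold Round.trueReward
    fun_prop
  · rw [Real.norm_of_nonneg (h t).trueReward.2.1]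
    exact (h t).trueReward.2.2

theorem integral_trueReward_last (p : Bandit K) (A : Algorithm K) (att : Attack K) (n : ℕ) :
    ∫ h, ((h (Fin.last n)).trueReward : ℝ) ∂(law p A att (n + 1)) =
      ∫ d, p.mean d.1 ∂(law p A att n ⊗ₘ decisionKernel A n).snd := by
  rw [law_succ, integral_map (measurable_appendRound att n).aemeasurable
    (Measurable.aestronglyMeasurable (by unfold Round.trueReward; fun_prop))]
  have happ : ∀ x, (appendRound att n x (Fin.last n)).trueReward = x.2 := fun x => by
    simp [appendRound, Round.trueReward]
  simp only [happ]
  rw [Measure.integral_compProd, Measure.snd,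
    integral_map (by fun_prop) Measurable.of_discrete.aestronglyMeasurable]
  · rfl
  · refine Integrable.of_bound (C := 1) (Measurable.aestronglyMeasurable (by fun_prop))
      (ae_of_all _ fun x => ?_)
    rw [Real.norm_of_nonneg x.2.2.1]
    exact x.2.2.2

theorem regret_succ (p : Bandit K) (b : Fin K) (A : Algorithm K) (att : Attack K) (n : ℕ) :
    regret p b A att (n + 1) = regret p b A att n +
      ∫ d, (p.mean b - p.mean d.1) ∂(law p A att n ⊗ₘ decisionKernel A n).snd := by
  have hinit : ∫ h, ∑ t, ((h t).trueReward : ℝ) ∂(law p A att n) =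
      ∫ h, ∑ t : Fin n, ((h t.castSucc).trueReward : ℝ) ∂(law p A att (n + 1)) := by
    rw [← law_map_init, integral_map (Measurable.aemeasurable (by fun_prop))
      (Measurable.aestronglyMeasurable (by unfold Round.trueReward; fun_prop))]
  rw [integral_sub (integrable_const _) (Integrable.of_finite), ← integral_trueReward_last]
  unfold regret
  simp only [Fin.sum_univ_castSucc]
  rw [integral_add (integrable_finsetSum _ fun t _ => integrable_trueReward p A att _)
    (integrable_trueReward p A att _), hinit]
  simp
  ring

theorem measureReal_last_arm (p : Bandit K) (A : Algorithm K) (att : Attack K) (n : ℕ)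
    (j : Fin K) :
    (law p A att (n + 1)).real {h | (h (Fin.last n)).arm = j} =
      (law p A att n ⊗ₘ decisionKernel A n).snd.real {d | d.1 = j} := by
  rw [← law_map_last_decision, map_measureReal_apply (by fun_prop) (MeasurableSet.of_discrete)]
  rfl

/-- Each round costs the expected gap of the arm played; all gaps are nonnegative, so only those of
`j` are kept. -/
theorem gap_mul_sum_le_regret {p : Bandit K} {b : Fin K} (hb : p.IsBest b) (j : Fin K)
    (A : Algorithm K) (att : Attack K) (T : ℕ) :
    (p.mean b - p.mean j) *
        ∑ n ∈ Finset.range T, (law p A att (n + 1)).real {h | (h (Fin.last n)).arm = j} ≤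
      regret p b A att T := by
  induction T with
  | zero => simp [regret]
  | succ n ih =>
    rw [Finset.sum_range_succ, mul_add, regret_succ, measureReal_last_arm]
    refine add_le_add ih ?_
    rw [mul_comm, ← smul_eq_mul, ← integral_indicator_const _ MeasurableSet.of_discrete]
    refine integral_mono Integrable.of_finite Integrable.of_finite fun d => ?_
    by_cases hd : d.1 = j
    · simp [hd]
    · have hle : p.mean d.1 ≤ p.mean b := by
        by_cases h : d.1 = b
        · rw [h]
        · exact (hb _ h).le
      simpa [hd] using hle

end Regret

/-! ### Change of measure and the regret lower bound -/

theorem measureReal_law_eq_obsLaw (p : Bandit K) (A : Algorithm K) (n : ℕ) (j : Fin K) :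
    (law p A (zeroAttack K) (n + 1)).real {h | (h (Fin.last n)).arm = j} =
      (obsLaw p A (n + 1)).real {h | (h (Fin.last n)).1.1 = j} := by
  rw [obsLaw, map_measureReal_apply (measurable_obsHistory_fun _)]
  · rfl
  · exact (measurableSet_singleton j).preimage (by fun_prop)

theorem expVerified_le_of_ae_lt {p q : Bandit K}
    (hac : ∀ i, (q i : Measure unitInterval) ≪ (p i : Measure unitInterval))
    (A : Algorithm K) (att : Attack K) {T : ℕ} {M : ℝ}
    (hM : ∀ᵐ h ∂(law p A att T), (numVerified h : ℝ) < M) :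
    expVerified q A att T ≤ ENNReal.ofReal M := by
  calc expVerified q A att T ≤ ∫⁻ _, ENNReal.ofReal M ∂(law q A att T) := by
        refine lintegral_mono_ae ?_
        filter_upwards [(law_absolutelyContinuous hac A att T).ae_le hM] with h hh
        rw [← ENNReal.ofReal_natCast]
        exact ENNReal.ofReal_le_ofReal hh.le
    _ = ENNReal.ofReal M := by simp

/-- If few rounds are verified, an arm that is usually played against the bandit `q` is not played
too rarely against `p`. -/
theorem exp_neg_le_measureReal_last_arm {p q : Bandit K} {C : ℝ} (hC0 : 0 ≤ C)
    (hC : ∀ i, klDiv (q i : Measure unitInterval) (p i : Measure unitInterval) ≤ ENNReal.ofReal C)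
    (A : Algorithm K) {T n : ℕ} (hn : n < T) {M : ℝ} (hM0 : 0 ≤ M)
    (hM : ∀ᵐ h ∂(law p A (zeroAttack K) T), (numVerified h : ℝ) < M) {j : Fin K}
    (hj : (law q A (zeroAttack K) (n + 1)).real {h | (h (Fin.last n)).arm ≠ j} ≤ 1 / 2) :
    1 / 2 * Real.exp (-(2 * (C * M + 1))) ≤
      (law p A (zeroAttack K) (n + 1)).real {h | (h (Fin.last n)).arm = j} := by
  have hac : ∀ i, (q i : Measure unitInterval) ≪ (p i : Measure unitInterval) := fun i =>
    (klDiv_ne_top_iff.1 (ne_top_of_le_ne_top ENNReal.ofReal_ne_top (hC i))).1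
  have hs : MeasurableSet {h : Fin (n + 1) → Round K | (h (Fin.last n)).arm = j} :=
    (measurableSet_singleton j).preimage (by unfold Round.arm; fun_prop)
  have hq : 1 / 2 ≤ (law q A (zeroAttack K) (n + 1)).real {h | (h (Fin.last n)).arm = j} := by
    have := probReal_add_probReal_compl (μ := law q A (zeroAttack K) (n + 1)) hs
    have hc : {h : Fin (n + 1) → Round K | (h (Fin.last n)).arm = j}ᶜ =
      {h | (h (Fin.last n)).arm ≠ j} := rfl
    rw [hc] at this
    linarith
  rw [measureReal_law_eq_obsLaw] at hq ⊢
  refine half_exp_neg_le_measureReal _ _ ((measurableSet_singleton j).preimage (by fun_prop)) hq ?_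
    (mul_nonneg hC0 hM0)
  refine (klDiv_obsLaw_le ENNReal.ofReal_ne_top hC A (n + 1)).trans ?_
  rw [ENNReal.ofReal_mul hC0]
  gcongr
  exact (expVerified_mono q A _ hn).trans (expVerified_le_of_ae_lt hac A _ hM)

theorem isBest_comp_swap {p : Bandit K} {b : Fin K} (hb : p.IsBest b) (j : Fin K) :
    Bandit.IsBest (p ∘ Equiv.swap b j) j := by
  intro i hi
  have h := hb (Equiv.swap b j i) fun h => hi (by
    simpa using congrArg (Equiv.swap b j) h)
  simpa [Bandit.mean] using h

/-- A consistent algorithm that verifies fewer than `M` rounds has regret at least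
`δ T exp (-C M)`. -/
theorem exists_mul_exp_le_regret (hK : 2 ≤ K) {p : Bandit K} {b : Fin K} (hb : p.IsBest b)
    (hfin : ∀ i j, p.kl i j ≠ ⊤) {D : Set (ProbabilityMeasure unitInterval)}
    (hD : ∀ i, p i ∈ D) :
    ∃ δ C : ℝ, 0 < δ ∧ 0 < C ∧ ∀ A : Algorithm K, IsConsistent D A (zeroAttack K) →
      ∃ t₀ : ℕ, ∀ T : ℕ, 2 * t₀ ≤ T → ∀ M : ℝ, 0 ≤ M →
        (∀ᵐ h ∂(law p A (zeroAttack K) T), (numVerified h : ℝ) < M) →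
        δ * T * Real.exp (-(C * M)) ≤ regret p b A (zeroAttack K) T := by
  have : Nontrivial (Fin K) := Fin.nontrivial_iff_two_le.2 hK
  obtain ⟨j, hj⟩ := exists_ne b
  set q : Bandit K := p ∘ Equiv.swap b j with hq
  obtain ⟨C, hC0, hC⟩ : ∃ C : ℝ, 0 < C ∧ ∀ i,
      klDiv (q i : Measure unitInterval) (p i : Measure unitInterval) ≤ ENNReal.ofReal C := by
    -- The sum dominates each term; the added 1 makes `C` positive.
    refine ⟨1 + ∑ i, (p.kl (Equiv.swap b j i) i).toReal, by positivity, fun i => ?_⟩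
    change p.kl (Equiv.swap b j i) i ≤ _
    rw [← ENNReal.ofReal_toReal (hfin (Equiv.swap b j i) i)]
    refine ENNReal.ofReal_le_ofReal ?_
    have := Finset.single_le_sum (f := fun i => (p.kl (Equiv.swap b j i) i).toReal)
      (fun i _ => ENNReal.toReal_nonneg) (Finset.mem_univ i)
    linarith
  have hgap : 0 < p.mean b - p.mean j := sub_pos.2 (hb j hj)
  -- One factor 1/2 and `exp (-2)` come from the change of measure, the other 1/2 from using only
  -- rounds after `t₀`.
  refine ⟨(p.mean b - p.mean j) * (1 / 4 * Real.exp (-2)), 2 * C, by positivity, by positivity,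
    fun A hA => ?_⟩
  obtain ⟨t₀, ht₀⟩ := eventually_atTop.1 ((hA q j (fun i => hD _)
    (isBest_comp_swap hb j)).eventually_le_const (by norm_num : (0 : ℝ) < 1 / 2))
  refine ⟨t₀, fun T hT M hM0 hM => le_trans ?_ (gap_mul_sum_le_regret hb j A _ T)⟩
  rw [mul_assoc, mul_assoc]
  refine mul_le_mul_of_nonneg_left ?_ hgap.le
  have hT' : (T : ℝ) / 2 ≤ ((Finset.Ico t₀ T).card : ℝ) := by
    have h2 : 2 * (t₀ : ℝ) ≤ T := by exact_mod_cast hT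
    rw [Nat.card_Ico, Nat.cast_sub (by omega)]
    linarith
  calc 1 / 4 * Real.exp (-2) * (T * Real.exp (-(2 * C * M)))
      = T / 2 * (1 / 2 * Real.exp (-(2 * (C * M + 1)))) := by
        rw [show -(2 * (C * M + 1)) = -2 + -(2 * C * M) by ring, Real.exp_add]
        ring
    _ ≤ (Finset.Ico t₀ T).card * (1 / 2 * Real.exp (-(2 * (C * M + 1)))) := by gcongr
    _ ≤ ∑ n ∈ Finset.Ico t₀ T,
          (law p A (zeroAttack K) (n + 1)).real {h | (h (Fin.last n)).arm = j} := by
        rw [← nsmul_eq_mul]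
        refine Finset.card_nsmul_le_sum _ _ _ fun n hn => ?_
        rw [Finset.mem_Ico] at hn
        exact exp_neg_le_measureReal_last_arm hC0.le hC A hn.2 hM0 hM (ht₀ n hn.1)
    _ ≤ _ := by
        refine Finset.sum_le_sum_of_subset_of_nonneg (fun n hn => ?_)
          fun _ _ _ => measureReal_nonneg
        rw [Finset.mem_Ico] at hn
        exact Finset.mem_range.2 hn.2

/-! ### Growth comparisons and conclusion -/

theorem tendsto_log_natCast_atTop : Tendsto (fun T : ℕ => Real.log T) atTop atTop :=
  Real.tendsto_log_atTop.comp tendsto_natCast_atTop_atTop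

/-- The right side is `δ √T`, which beats every power of `log T`. -/
theorem eventually_mul_log_rpow_lt {δ : ℝ} (hδ : 0 < δ) (a β : ℝ) :
    ∀ᶠ T : ℕ in atTop, a * Real.log T ^ β < δ * T * Real.exp (-(Real.log T / 2)) := by
  have hβ : ∀ᶠ x : ℝ in atTop, a * x ^ β < δ * Real.exp (1 / 2 * x) := by
    have h := (isLittleO_rpow_exp_pos_mul_atTop β (by norm_num : (0 : ℝ) < 1 / 2)).bound
      (div_pos hδ (by positivity : 0 < |a| + 1))
    filter_upwards [h, eventually_gt_atTop 0] with x hx hx0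
    rw [Real.norm_of_nonneg (by positivity), Real.norm_of_nonneg (Real.exp_pos _).le,
      div_mul_eq_mul_div, le_div_iff₀ (by positivity)] at hx
    have hpos : 0 < x ^ β := by positivity
    nlinarith [mul_le_mul_of_nonneg_right (le_abs_self a) hpos.le]
  filter_upwards [tendsto_log_natCast_atTop.eventually hβ, eventually_gt_atTop 0] with T hT hT0
  have hT0' : (0 : ℝ) < T := by exact_mod_cast hT0
  refine hT.trans_eq ?_
  rw [mul_assoc]
  nth_rw 2 [← Real.exp_log hT0']
  rw [← Real.exp_add]
  ring_nf

theorem eventually_mul_log_rpow_le {α : ℝ} (hα : 0 < α) (C : ℝ) :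
    ∀ᶠ T : ℕ in atTop, C * Real.log T ^ (1 - α) ≤ Real.log T / 2 := by
  have h : ∀ᶠ x : ℝ in atTop, C * x ^ (1 - α) ≤ x / 2 := by
    filter_upwards [(tendsto_rpow_atTop hα).eventually_ge_atTop (2 * C), eventually_gt_atTop 0]
      with x hx hx0
    have hpos : 0 < x ^ (1 - α) := by positivity
    have hmul : x ^ α * x ^ (1 - α) = x := by
      rw [← Real.rpow_add hx0]
      simp
    nlinarith
  exact tendsto_log_natCast_atTop.eventually h

end VerifiedBandit

theorem theorem2 {K : ℕ} (hK : 2 ≤ K)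
    (p : VerifiedBandit.Bandit K) (istar : Fin K) (hbest : p.IsBest istar)
    (hfin : ∀ i j, p.kl i j ≠ ⊤)
    (D : Set (MeasureTheory.ProbabilityMeasure unitInterval)) (hD : ∀ i, p i ∈ D) :
    ((∀ i j, i ≠ j → p.kl i j ≠ 0) →
      ∃ c : ℝ, 0 < c ∧
      ∀ α β : ℝ, 0 < α → α < 1 → 1 < β →
      ∀ A : VerifiedBandit.Algorithm K,
        VerifiedBandit.IsConsistent D A (VerifiedBandit.zeroAttack K) →
      ∃ tstar : ℕ, ∀ T : ℕ, 2 * tstar ≤ T →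
        Real.log T ^ (1 - α) + β * Real.log (4 * Real.log T) ≤ Real.log T →
        (∀ᵐ h ∂(VerifiedBandit.law p A (VerifiedBandit.zeroAttack K) T),
          (VerifiedBandit.numVerified h : ℝ) < Real.log T ^ (1 - α) / p.minKL.toReal) →
        c * Real.log T ^ β ≤
          VerifiedBandit.regret p istar A (VerifiedBandit.zeroAttack K) T) ∧
    (∃ c : ℝ, 0 < c ∧
      ∀ A : VerifiedBandit.Algorithm K,
        VerifiedBandit.IsConsistent D A (VerifiedBandit.zeroAttack K) →
        (fun T : ℕ => VerifiedBandit.regret p istar A (VerifiedBandit.zeroAttack K) T)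
          =O[Filter.atTop] (fun T : ℕ => Real.log T) →
        ∀ᶠ T : ℕ in Filter.atTop,
          ¬ ∀ᵐ h ∂(VerifiedBandit.law p A (VerifiedBandit.zeroAttack K) T),
            (VerifiedBandit.numVerified h : ℝ) < c * Real.log T) := by
  obtain ⟨δ, C, hδ, hC, hcore⟩ :=
    VerifiedBandit.exists_mul_exp_le_regret hK hbest hfin hD
  -- `c = 1` suffices in the first claim because `tstar` may depend on `α`, `β` and `A`.
  refine ⟨fun _ => ⟨1, one_pos, fun α β hα _ _ A hA => ?_⟩,
    -- This value makes the exponent exactly `log T / 2`.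
    1 / (2 * C), by positivity, fun A hA hO => ?_⟩
  · obtain ⟨t₀, ht₀⟩ := hcore A hA
    obtain ⟨N, hN⟩ := eventually_atTop.1
      ((VerifiedBandit.eventually_mul_log_rpow_lt hδ 1 β).and
        (VerifiedBandit.eventually_mul_log_rpow_le hα (C / p.minKL.toReal)))
    refine ⟨max t₀ N, fun T hT _ hver => ?_⟩
    obtain ⟨h1, h2⟩ := hN T (by omega)
    refine (h1.le.trans ?_).trans (ht₀ T (by omega) _ ?_ hver)
    · gcongr
      exact (mul_div_assoc' C _ _).trans (div_mul_eq_mul_div C _ _).symm |>.trans_le h2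
    · have := Real.log_natCast_nonneg T
      positivity
  · obtain ⟨t₀, ht₀⟩ := hcore A hA
    obtain ⟨a, ha⟩ := hO.bound
    filter_upwards [ha, VerifiedBandit.eventually_mul_log_rpow_lt hδ a 1,
      eventually_ge_atTop (2 * t₀)] with T hT1 hT2 hT3 hver
    have hlog := Real.log_natCast_nonneg T
    have h := ht₀ T hT3 _ (by positivity) hver
    rw [Real.rpow_one] at hT2
    rw [Real.norm_of_nonneg hlog] at hT1
    have h' := (le_abs_self _).trans hT1
    rw [show C * (1 / (2 * C) * Real.log T) = Real.log T / 2 by field_simp] at h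
    linarith
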